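/- There is a universal constant $C > 0$ such that the following holds. Let $d \ge 1$, let $\sigma$ be a fixed $d$-dimensional quantum state (a positive semidefinite matrix in $\mathbb{C}^{d\times d}$ of trace one), let $\varepsilon > 0$, and let $T$ be an integer with $T \ge C\,d/\varepsilon^2$. Then there is an algorithm (a two-outcome quantum measurement on $(\mathbb{C}^d)^{\otimes T}$, with outcomes "accept" and "reject", depending only on $d$, $\sigma$, $\varepsilon$ and $T$) such that for all $d$-dimensional quantum states $\rho_1,\dots,\rho_T$, with average $\rho_{\mathrm{avg}} = \frac1T\sum_{i=1}^T \rho_i$, when it is given one copy of each $\rho_i$, i.e. when it is applied to $\rho_1\otimes\cdots\otimes\rho_T$: - if $\rho_{\mathrm{avg}} = \sigma$, it accepts with probability at least $0.99$; - if $D_{\mathrm{tr}}(\rho_{\mathrm{avg}},\sigma) > \varepsilon$, it rejects with probability at least $0.99$. Here $D_{\mathrm{tr}}(\rho,\sigma) = \frac12\|\rho-\sigma\|_1$ is the trace distance, with $\|\cdot\|_1$ the Schatten $1$-norm (the sum of the singular values). -/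

import Mathlib

open scoped ComplexOrder

/-- A quantum state on `ℂ^ι`: a positive semidefinite matrix of trace one. -/
def IsQuantumState {ι : Type*} [Fintype ι] (ρ : Matrix ι ι ℂ) : Prop :=
  ρ.PosSemidef ∧ ρ.trace = 1

/-- The Schatten 1-norm of a square matrix: the sum of its singular values, i.e. of the square
roots of the eigenvalues (with multiplicity) of `Aᴴ * A`. -/
noncomputable def schattenOneNorm {ι : Type*} [Fintype ι] [DecidableEq ι]
    (A : Matrix ι ι ℂ) : ℝ :=
  ∑ i, √((Matrix.posSemidef_conjTranspose_mul_self A).isHermitian.eigenvalues i)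

/-- The trace distance `½ ‖ρ - σ‖₁`. -/
noncomputable def traceDistance {ι : Type*} [Fintype ι] [DecidableEq ι]
    (ρ σ : Matrix ι ι ℂ) : ℝ :=
  1 / 2 * schattenOneNorm (ρ - σ)

/-- The tensor product `ρ 0 ⊗ ⋯ ⊗ ρ (T - 1)`, as a matrix on `(ℂ^d)^{⊗ T}`, whose standard basis
vectors are indexed by the words `Fin T → Fin d`. -/
def productState {d T : ℕ} (ρ : Fin T → Matrix (Fin d) (Fin d) ℂ) :
    Matrix (Fin T → Fin d) (Fin T → Fin d) ℂ :=
  Matrix.of fun x y => ∏ i, ρ i (x i) (y i)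

/-- The average `(1 / T) ∑ i, ρ i`. -/
noncomputable def averageState {d T : ℕ} (ρ : Fin T → Matrix (Fin d) (Fin d) ℂ) :
    Matrix (Fin d) (Fin d) ℂ :=
  (T : ℂ)⁻¹ • ∑ i, ρ i

/-- A quantum measurement (POVM) on `ℂ^ι` with finitely many outcomes `Ω`. -/
structure QuantumMeasurement (ι Ω : Type*) [Fintype ι] [DecidableEq ι] [Fintype Ω] where
  /-- the operator of each outcome -/
  effect : Ω → Matrix ι ι ℂ
  effect_posSemidef : ∀ ω, (effect ω).PosSemidef
  sum_effect : ∑ ω, effect ω = 1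

/-- Born rule: the probability `Tr[ρ E_ω]` of the outcome `ω` when measuring the state `ρ`. -/
noncomputable def QuantumMeasurement.prob {ι Ω : Type*} [Fintype ι] [DecidableEq ι] [Fintype Ω]
    (M : QuantumMeasurement ι Ω) (ρ : Matrix ι ι ℂ) (ω : Ω) : ℝ :=
  (ρ * M.effect ω).trace.re

/-- A testing algorithm that gets one copy of each of `T` states of dimension `d`: an arbitrary
(possibly entangled) two-outcome measurement on `(ℂ^d)^{⊗ T}`; outcome `true` means "accept",
outcome `false` means "reject". -/
abbrev OneCopyTester (d T : ℕ) := QuantumMeasurement (Fin T → Fin d) Bool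

/-!
The tester measures a spectral threshold of one observable on `(ℂ^d)^{⊗ T}`,

  `G = ∑_{i ≠ j} SWAP_{ij} - 2 T ∑ i, σ_i + T² tr(σ²)`,

where `σ_i` is `σ` acting on the `i`-th tensor factor, and it accepts when the outcome is at most
`200 T`. Put `D = ∑ i, ρ i - T σ`, which is `T` times the deviation of the average state from `σ`,
and `s = tr(D²)`. Since `tr((ρ ⊗ τ) SWAP) = tr(ρ τ)`, the expectation of `G` in
`ρ 0 ⊗ ⋯ ⊗ ρ (T - 1)` is `s - ∑ i, tr(ρ i ²)`. The purities `tr(ρ i ²)` cannot be estimated from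
single copies, but they bias the mean by at most `T`, which is below the resolution of the test.

The variance is controlled by the Hoeffding decomposition
`G - 𝔼 G = W + 2 L` (`certificationObservable_sub_eq`). Here `W` is the sum over `i ≠ j` of swaps
centered in both factors (`centeredSwap`), which are pairwise uncorrelated except for a pair and
its reversal, and `L` is a sum of the centered one-factor operators obtained from `D - ρ i`.
This gives `𝔼 W² ≤ 32 T²` and `𝔼 L² ≤ T (2 s + 2)`, hence a variance of at most `80 T² + 16 T s`
(`exists_mean_and_variance_le`).

If the average state is `σ`, then `s = 0` and the mean is nonpositive. If it is `ε`-far from `σ` in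
trace distance, then `‖A‖₁² ≤ d tr(A²)` for Hermitian `A` (`schattenOneNorm_sq_le`) gives
`s > 4 ε² T² / d ≥ 4000 T` once `T ≥ 1000 d / ε²`. In both cases Chebyshev's inequality
for the spectral measure of `G` (`exists_threshold_measurement`) bounds the error by `1 / 100`.
-/

/-! ### Expectations, the spectral Chebyshev inequality and the trace norm -/

section Expectation

open Matrix
open scoped MatrixOrder

variable {ι : Type*} [Fintype ι] [DecidableEq ι]

theorem re_trace_mul_nonneg {ρ M : Matrix ι ι ℂ} (hρ : ρ.PosSemidef) (hM : M.PosSemidef) :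
    0 ≤ (ρ * M).trace.re := by
  obtain ⟨B, rfl⟩ := CStarAlgebra.nonneg_iff_eq_star_mul_self.mp hρ.nonneg
  have h := (hM.mul_mul_conjTranspose_same B).trace_nonneg
  rw [trace_mul_cycle, ← star_eq_conjTranspose] at h
  exact (Complex.le_def.mp h).1

theorem re_trace_mul_mono {ρ A B : Matrix ι ι ℂ} (hρ : ρ.PosSemidef) (h : A ≤ B) :
    (ρ * A).trace.re ≤ (ρ * B).trace.re := by
  have := re_trace_mul_nonneg hρ (Matrix.le_iff.mp h)
  rw [mul_sub, trace_sub, Complex.sub_re] at this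
  linarith

/-- The inequality `(a + b)² ≤ 2 a² + 2 b²` for expectations of noncommuting observables, from the
nonnegativity of the expectation of `(A - B)²`. -/
theorem re_trace_mul_add_sq_le {ρ A B : Matrix ι ι ℂ} (hρ : ρ.PosSemidef)
    (hA : A.IsHermitian) (hB : B.IsHermitian) :
    (ρ * ((A + B) * (A + B))).trace.re ≤
      2 * (ρ * (A * A)).trace.re + 2 * (ρ * (B * B)).trace.re := by
  have h := re_trace_mul_nonneg hρ (posSemidef_conjTranspose_mul_self (A - B))
  rw [(hA.sub hB).eq] at h
  simp only [mul_add, add_mul, mul_sub, sub_mul, trace_add, trace_sub, Complex.add_re,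
    Complex.sub_re] at h ⊢
  linarith

theorem IsQuantumState.le_one {ρ : Matrix ι ι ℂ} (hρ : IsQuantumState ρ) : ρ ≤ 1 := by
  have hH := hρ.1.isHermitian
  have hsum : ∑ k, hH.eigenvalues k = 1 := by
    have := hH.trace_eq_sum_eigenvalues
    rw [hρ.2] at this
    apply Complex.ofReal_injective
    simpa using this.symm
  have hle : ∀ x ∈ spectrum ℝ ρ, x ≤ 1 := by
    intro x hx
    rw [hH.spectrum_real_eq_range_eigenvalues] at hx
    obtain ⟨k, rfl⟩ := hx
    rw [← hsum]
    exact Finset.single_le_sum (fun i _ => hρ.1.eigenvalues_nonneg i) (Finset.mem_univ k)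
  have hsa : IsSelfAdjoint ρ := hH
  have := cfc_mono (a := ρ) (f := id) (g := fun _ => (1 : ℝ)) hle
  rwa [cfc_id ℝ ρ, cfc_const_one ℝ ρ] at this

/-- Chebyshev's inequality for the spectral measure of an observable `H` in a state `ρ`: the
projections onto the eigenvalues `≤ θ` and `> θ` form a measurement, and each of its outcomes is
bounded through the second moment of `H` about any point `m` on the other side of `θ`. -/
theorem exists_threshold_measurement {H : Matrix ι ι ℂ} (hH : H.IsHermitian) (θ : ℝ) :
    ∃ M : QuantumMeasurement ι Bool, ∀ ρ : Matrix ι ι ℂ, IsQuantumState ρ →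
      M.prob ρ true + M.prob ρ false = 1 ∧
      ∀ m : ℝ,
        (m < θ → M.prob ρ false * (θ - m) ^ 2 ≤
          (ρ * ((H - (m : ℂ) • 1) * (H - (m : ℂ) • 1))).trace.re) ∧
        (θ < m → M.prob ρ true * (θ - m) ^ 2 ≤
          (ρ * ((H - (m : ℂ) • 1) * (H - (m : ℂ) • 1))).trace.re) := by
  have hsa : IsSelfAdjoint H := hH
  -- The spectrum is finite, so the functional calculus applies to discontinuous indicators.
  have hc : ∀ f : ℝ → ℝ, ContinuousOn f (spectrum ℝ H) := fun f =>
    (Matrix.finite_real_spectrum (A := H)).continuousOn f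
  have hsum : cfc (fun x : ℝ => if x ≤ θ then (1 : ℝ) else 0) H +
      cfc (fun x : ℝ => if x ≤ θ then (0 : ℝ) else 1) H = 1 := by
    rw [← cfc_add H _ _ (hc _) (hc _), ← cfc_const_one ℝ H]
    congr 1; ext x; split_ifs <;> simp
  let M : QuantumMeasurement ι Bool :=
    { effect := fun b => cond b (cfc (fun x : ℝ => if x ≤ θ then (1 : ℝ) else 0) H)
        (cfc (fun x : ℝ => if x ≤ θ then (0 : ℝ) else 1) H)
      effect_posSemidef := by
        rintro (_ | _)
        · exact (cfc_nonneg fun x _ => by split_ifs <;> norm_num).posSemidef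
        · exact (cfc_nonneg fun x _ => by split_ifs <;> norm_num).posSemidef
      sum_effect := by simpa using hsum }
  have hsq : ∀ m : ℝ, cfc (fun x : ℝ => (x - m) ^ 2) H =
      (H - (m : ℂ) • 1) * (H - (m : ℂ) • 1) := by
    intro m
    rw [cfc_pow (fun x : ℝ => x - m) 2 H (hc _),
      cfc_sub (fun x : ℝ => x) (fun _ => m) H (hc _) (hc _),
      cfc_id' ℝ H, cfc_const m H, sq, Algebra.algebraMap_eq_smul_one]
    rfl
  have key : ∀ (ρ : Matrix ι ι ℂ), ρ.PosSemidef → ∀ (m : ℝ) (f : ℝ → ℝ),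
      (∀ x, (θ - m) ^ 2 * f x ≤ (x - m) ^ 2) →
      (ρ * cfc f H).trace.re * (θ - m) ^ 2 ≤
        (ρ * ((H - (m : ℂ) • 1) * (H - (m : ℂ) • 1))).trace.re := by
    intro ρ hρ m f hf
    have h1 := re_trace_mul_mono hρ (cfc_mono (a := H) (f := fun x => (θ - m) ^ 2 * f x)
      (g := fun x => (x - m) ^ 2) (fun x _ => hf x) (hc _) (hc _))
    rw [hsq, cfc_const_mul _ _ _ (hc _), mul_smul_comm, trace_smul, Complex.smul_re,
      smul_eq_mul] at h1
    linarith
  refine ⟨M, fun ρ hρ => ⟨?_, fun m => ⟨fun hm => ?_, fun hm => ?_⟩⟩⟩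
  · have := congrArg (fun X => (ρ * X).trace.re) hsum
    simp only [mul_add, trace_add, Complex.add_re, mul_one, hρ.2, Complex.one_re] at this
    exact this
  · refine key ρ hρ.1 m _ fun x => ?_
    split_ifs with h
    · simpa using sq_nonneg (x - m)
    · rw [mul_one]
      exact pow_le_pow_left₀ (by linarith) (by linarith) 2
  · refine key ρ hρ.1 m _ fun x => ?_
    split_ifs with h
    · nlinarith
    · simpa using sq_nonneg (x - m)

/-- Cauchy–Schwarz on the singular values: `‖A‖₁² ≤ (dim) ‖A‖₂²`. -/
theorem schattenOneNorm_sq_le {A : Matrix ι ι ℂ} (hA : A.IsHermitian) :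
    schattenOneNorm A ^ 2 ≤ Fintype.card ι * (A * A).trace.re := by
  have hP := posSemidef_conjTranspose_mul_self A
  have htr := congrArg Complex.re hP.isHermitian.trace_eq_sum_eigenvalues
  have h := sq_sum_le_card_mul_sum_sq (s := Finset.univ)
    (f := fun i => √(hP.isHermitian.eigenvalues i))
  simp only [Real.sq_sqrt (hP.eigenvalues_nonneg _)] at h
  simp only [Complex.coe_algebraMap, Complex.re_sum] at htr
  have hAA : (A * A).trace.re = (Aᴴ * A).trace.re := by rw [hA.eq]
  rw [hAA, htr]
  exact h

end Expectation

/-! ### Local operators and swaps on a tensor power -/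

section Product

open Matrix

variable {d T : ℕ}

theorem productState_mul (A B : Fin T → Matrix (Fin d) (Fin d) ℂ) :
    productState A * productState B = productState (A * B) := by
  ext x z
  simp only [productState, mul_apply, of_apply, Pi.mul_apply]
  rw [Finset.prod_univ_sum, Fintype.piFinset_univ]
  simp only [Finset.prod_mul_distrib]

theorem trace_productState (A : Fin T → Matrix (Fin d) (Fin d) ℂ) :
    (productState A).trace = ∏ i, (A i).trace := by
  simp only [productState, trace, diag_apply, of_apply]
  rw [Finset.prod_univ_sum, Fintype.piFinset_univ]

theorem productState_one : productState (1 : Fin T → Matrix (Fin d) (Fin d) ℂ) = 1 := by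
  ext x y
  simp only [productState, of_apply, Pi.one_apply, one_apply]
  rw [Finset.prod_ite_zero]
  simp [funext_iff]

theorem productState_conjTranspose (A : Fin T → Matrix (Fin d) (Fin d) ℂ) :
    (productState A)ᴴ = productState fun i => (A i)ᴴ := by
  ext x y
  simp [productState, conjTranspose_apply]

open scoped MatrixOrder in
theorem isQuantumState_productState {ρ : Fin T → Matrix (Fin d) (Fin d) ℂ}
    (hρ : ∀ i, IsQuantumState (ρ i)) : IsQuantumState (productState ρ) := by
  constructor
  · choose B hB using fun i => CStarAlgebra.nonneg_iff_eq_star_mul_self.mp (hρ i).1.nonneg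
    have : productState ρ = (productState B)ᴴ * productState B := by
      rw [productState_conjTranspose, productState_mul]
      congr 1
      ext1 i
      exact hB i
    rw [this]
    exact posSemidef_conjTranspose_mul_self _
  · rw [trace_productState]
    exact Finset.prod_eq_one fun i _ => (hρ i).2

theorem productState_update_apply (A : Fin T → Matrix (Fin d) (Fin d) ℂ) (i : Fin T)
    (X : Matrix (Fin d) (Fin d) ℂ) (x y : Fin T → Fin d) :
    productState (Function.update A i X) x y =
      X (x i) (y i) * ∏ k ∈ Finset.univ.erase i, A k (x k) (y k) := by
  simp only [productState, of_apply]
  rw [← Finset.mul_prod_erase _ _ (Finset.mem_univ i), Function.update_self]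
  congr 1
  refine Finset.prod_congr rfl fun k hk => ?_
  rw [Function.update_of_ne (Finset.ne_of_mem_erase hk)]

/-- `localOp i X` is `1 ⊗ ⋯ ⊗ X ⊗ ⋯ ⊗ 1`, the operator `X` acting on the `i`-th tensor factor. -/
noncomputable def localOp (i : Fin T) :
    Matrix (Fin d) (Fin d) ℂ →ₐ[ℂ] Matrix (Fin T → Fin d) (Fin T → Fin d) ℂ :=
  AlgHom.ofLinearMap
    { toFun := fun X => productState (Pi.mulSingle i X)
      map_add' := fun X Y => by
        ext x y
        simp only [Pi.mulSingle, productState_update_apply, Matrix.add_apply, add_mul]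
      map_smul' := fun c X => by
        ext x y
        simp only [Pi.mulSingle, productState_update_apply, Matrix.smul_apply, smul_eq_mul,
          RingHom.id_apply, mul_assoc] }
    (by simp [Pi.mulSingle_one, productState_one])
    (fun X Y => by simp [productState_mul, Pi.mulSingle_mul])

theorem localOp_apply (i : Fin T) (X : Matrix (Fin d) (Fin d) ℂ) :
    localOp i X = productState (Pi.mulSingle i X) := rfl

theorem localOp_commute {i j : Fin T} (h : i ≠ j) (X Y : Matrix (Fin d) (Fin d) ℂ) :
    localOp i X * localOp j Y = localOp j Y * localOp i X := by
  simp only [localOp_apply, productState_mul]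
  exact congrArg _ (Pi.mulSingle_commute (f := fun _ => Matrix (Fin d) (Fin d) ℂ) h X Y).eq

theorem localOp_conjTranspose (i : Fin T) (X : Matrix (Fin d) (Fin d) ℂ) :
    (localOp i X)ᴴ = localOp i Xᴴ := by
  rw [localOp_apply, localOp_apply, productState_conjTranspose]
  congr 1
  ext1 k
  by_cases h : k = i
  · subst h; simp
  · simp [Pi.mulSingle_eq_of_ne h]

theorem trace_productState_mul_productState (ρ B : Fin T → Matrix (Fin d) (Fin d) ℂ) :
    (productState ρ * productState B).trace = ∏ k, (ρ k * B k).trace := by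
  rw [productState_mul, trace_productState]; rfl

theorem trace_productState_mul_localOp {ρ : Fin T → Matrix (Fin d) (Fin d) ℂ}
    (hρ : ∀ i, IsQuantumState (ρ i)) (i : Fin T) (X : Matrix (Fin d) (Fin d) ℂ) :
    (productState ρ * localOp i X).trace = (ρ i * X).trace := by
  rw [localOp_apply, trace_productState_mul_productState, Finset.prod_eq_single i]
  · simp
  · intro k _ hk
    simp [Pi.mulSingle_eq_of_ne hk, (hρ k).2]
  · simp

/-- A local operator of zero expectation annihilates the expectation of any product in which the
other three factors act elsewhere; these three may share tensor factors. -/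
theorem trace_localOp_mul_eq_zero (ρ : Fin T → Matrix (Fin d) (Fin d) ℂ) {i j k l : Fin T}
    (hj : i ≠ j) (hk : i ≠ k) (hl : i ≠ l) {X : Matrix (Fin d) (Fin d) ℂ}
    (hX : (ρ i * X).trace = 0) (Y Z W : Matrix (Fin d) (Fin d) ℂ) :
    (productState ρ * (localOp i X * localOp j Y * (localOp k Z * localOp l W))).trace = 0 := by
  simp only [localOp_apply, productState_mul]
  rw [trace_productState]
  refine Finset.prod_eq_zero (Finset.mem_univ i) ?_
  simpa [Pi.mulSingle_eq_of_ne hj, Pi.mulSingle_eq_of_ne hk, Pi.mulSingle_eq_of_ne hl] using hX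

/-- `X` centered in the state `ρ`: the operator `X - tr(ρ X)`, of zero expectation in `ρ`. -/
noncomputable def centerAt (ρ X : Matrix (Fin d) (Fin d) ℂ) : Matrix (Fin d) (Fin d) ℂ :=
  X - (ρ * X).trace • 1

theorem trace_mul_centerAt {ρ : Matrix (Fin d) (Fin d) ℂ} (hρ : IsQuantumState ρ)
    (X : Matrix (Fin d) (Fin d) ℂ) : (ρ * centerAt ρ X).trace = 0 := by
  simp [centerAt, mul_sub, hρ.2]

/-- The operator exchanging the tensor factors `i ≠ j`, written as `∑ a b, |a⟩⟨b| ⊗ |b⟩⟨a|`. For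
`i = j` the formula gives `d • 1` instead. -/
noncomputable def swapOp (i j : Fin T) : Matrix (Fin T → Fin d) (Fin T → Fin d) ℂ :=
  ∑ a : Fin d, ∑ b : Fin d, localOp i (single a b 1) * localOp j (single b a 1)

theorem swapOp_comm {i j : Fin T} (h : i ≠ j) : swapOp (d := d) i j = swapOp j i := by
  rw [swapOp, swapOp, Finset.sum_comm]
  simp only [localOp_commute h]

theorem swapOp_isHermitian {i j : Fin T} (h : i ≠ j) : (swapOp (d := d) i j).IsHermitian := by
  rw [IsHermitian, swapOp, conjTranspose_sum, Finset.sum_comm]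
  simp only [conjTranspose_sum, conjTranspose_mul, localOp_conjTranspose, conjTranspose_single,
    star_one, localOp_commute h.symm]

theorem sum_single_self : ∑ a : Fin d, (single a a 1 : Matrix (Fin d) (Fin d) ℂ) = 1 := by
  ext x y
  simp only [Matrix.sum_apply, single_apply, one_apply, ite_and, Finset.sum_ite_eq',
    Finset.mem_univ, if_true]

theorem swapOp_mul_self {i j : Fin T} (h : i ≠ j) : swapOp (d := d) i j * swapOp i j = 1 := by
  have key : ∀ a b c e : Fin d,
      (localOp i (single a b 1) * localOp j (single b a 1)) *
        (localOp i (single c e 1) * localOp j (single e c 1)) =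
      if b = c ∧ a = e then localOp i (single a a (1 : ℂ)) * localOp j (single b b (1 : ℂ))
        else (0 : Matrix (Fin T → Fin d) (Fin T → Fin d) ℂ) := by
    intro a b c e
    rw [mul_assoc, ← mul_assoc (localOp j _), localOp_commute h.symm, mul_assoc, ← mul_assoc,
      ← map_mul, ← map_mul]
    split_ifs with hh
    · obtain ⟨rfl, rfl⟩ := hh
      simp
    · rw [not_and_or] at hh
      rcases hh with hh | hh
      · rw [single_mul_single_of_ne _ _ _ _ hh, map_zero, zero_mul]
      · rw [single_mul_single_of_ne _ _ _ _ hh, map_zero, mul_zero]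
  simp only [swapOp, Finset.sum_mul, Finset.mul_sum, key]
  simp only [ite_and, Finset.sum_ite_eq', Finset.mem_univ, if_true]
  rw [Finset.sum_comm, ← Finset.sum_mul_sum, ← map_sum, ← map_sum, sum_single_self, map_one,
    map_one, one_mul]

/-- The part of the swap of the factors `i ≠ j` that is degenerate in the state `ρ`: in the
expansion `∑ a b, |a⟩⟨b| ⊗ |b⟩⟨a|` both factors are centered, so that either partial
expectation vanishes. -/
noncomputable def centeredSwap (ρ : Fin T → Matrix (Fin d) (Fin d) ℂ) (i j : Fin T) :
    Matrix (Fin T → Fin d) (Fin T → Fin d) ℂ :=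
  ∑ a : Fin d, ∑ b : Fin d,
    localOp i (centerAt (ρ i) (single a b 1)) * localOp j (centerAt (ρ j) (single b a 1))

theorem trace_mul_single_one (ρ : Matrix (Fin d) (Fin d) ℂ) (a b : Fin d) :
    (ρ * single a b 1).trace = ρ b a := by
  simp [Matrix.trace_mul_single]

theorem sum_smul_single (ρ : Matrix (Fin d) (Fin d) ℂ) :
    ∑ a : Fin d, ∑ b : Fin d, ρ a b • (single a b 1 : Matrix (Fin d) (Fin d) ℂ) = ρ := by
  conv_rhs => rw [matrix_eq_sum_single ρ]
  simp [smul_single]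

/-- The Hoeffding decomposition of a swap, solved for its degenerate part. -/
theorem centeredSwap_eq (ρ : Fin T → Matrix (Fin d) (Fin d) ℂ) (i j : Fin T) :
    centeredSwap ρ i j = swapOp i j - localOp i (ρ j) - localOp j (ρ i) +
      (ρ i * ρ j).trace • 1 := by
  have h1 : ∑ a : Fin d, ∑ b : Fin d,
      ρ j a b • (localOp i (single a b 1) : Matrix (Fin T → Fin d) (Fin T → Fin d) ℂ) =
      localOp i (ρ j) := by
    conv_rhs => rw [← sum_smul_single (ρ j)]
    simp only [map_sum, map_smul]
  have h2 : ∑ a : Fin d, ∑ b : Fin d,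
      ρ i b a • (localOp j (single b a 1) : Matrix (Fin T → Fin d) (Fin T → Fin d) ℂ) =
      localOp j (ρ i) := by
    conv_rhs => rw [← sum_smul_single (ρ i), Finset.sum_comm]
    simp only [map_sum, map_smul]
  have h3 : ∑ a : Fin d, ∑ b : Fin d, ρ j a b * ρ i b a = (ρ i * ρ j).trace := by
    rw [trace_mul_comm]; simp [trace, mul_apply]
  simp only [centeredSwap, centerAt, trace_mul_single_one, map_sub, map_smul, map_one, sub_mul,
    mul_sub, Finset.sum_sub_distrib, smul_mul_assoc, mul_smul_comm, one_mul, mul_one, smul_sub,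
    smul_smul, ← Finset.sum_smul, h1, h2, h3, swapOp]
  abel

end Product

/-! ### Second moments in a product state -/

section Moments

open Matrix

variable {d T : ℕ}

theorem trace_mul_eq_ofReal_re {ι : Type*} [Fintype ι] {A B : Matrix ι ι ℂ}
    (hA : A.IsHermitian) (hB : B.IsHermitian) :
    (A * B).trace = ((A * B).trace.re : ℂ) := by
  refine (Complex.conj_eq_iff_re.mp ?_).symm
  rw [starRingEnd_apply, ← trace_conjTranspose, conjTranspose_mul, hA.eq, hB.eq, trace_mul_comm]

theorem isHermitian_ofReal_smul_one {ι : Type*} [DecidableEq ι] (c : ℝ) :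
    ((c : ℂ) • (1 : Matrix ι ι ℂ)).IsHermitian := by
  rw [IsHermitian, conjTranspose_smul, conjTranspose_one]
  simp

theorem localOp_isHermitian (i : Fin T) {X : Matrix (Fin d) (Fin d) ℂ} (hX : X.IsHermitian) :
    (localOp i X).IsHermitian := by
  rw [IsHermitian, localOp_conjTranspose, hX.eq]

theorem IsQuantumState.re_trace_mul_le_one {ι : Type*} [Fintype ι] [DecidableEq ι]
    {ρ τ : Matrix ι ι ℂ} (hρ : IsQuantumState ρ) (hτ : IsQuantumState τ) :
    (ρ * τ).trace.re ≤ 1 := by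
  have := re_trace_mul_mono hρ.1 hτ.le_one
  simpa [hρ.2] using this

theorem IsQuantumState.re_trace_mul_sq_le {ι : Type*} [Fintype ι] [DecidableEq ι]
    {ρ X : Matrix ι ι ℂ} (hρ : IsQuantumState ρ) (hX : X.IsHermitian) :
    (ρ * (X * X)).trace.re ≤ (X * X).trace.re := by
  have hXX : (X * X).PosSemidef := by
    simpa [hX.eq] using posSemidef_conjTranspose_mul_self X
  have := re_trace_mul_mono hXX hρ.le_one
  rwa [mul_one, trace_mul_comm] at this

theorem isHermitian_centerAt {ρ X : Matrix (Fin d) (Fin d) ℂ} (hρ : ρ.IsHermitian)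
    (hX : X.IsHermitian) : (centerAt ρ X).IsHermitian := by
  rw [centerAt, trace_mul_eq_ofReal_re hρ hX]
  exact hX.sub (isHermitian_ofReal_smul_one _)

theorem re_trace_mul_centerAt_sq_le {ρ X : Matrix (Fin d) (Fin d) ℂ} (hρ : IsQuantumState ρ)
    (hX : X.IsHermitian) :
    (ρ * (centerAt ρ X * centerAt ρ X)).trace.re ≤ (ρ * (X * X)).trace.re := by
  have h := trace_mul_eq_ofReal_re hρ.1.isHermitian hX
  rw [centerAt, h]
  simp only [mul_sub, sub_mul, smul_mul_assoc, mul_smul_comm, one_mul, mul_one, trace_sub,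
    trace_smul, hρ.2, smul_eq_mul]
  rw [h]
  simp only [Complex.sub_re, Complex.mul_re, Complex.ofReal_re, Complex.ofReal_im, mul_zero,
    sub_zero]
  nlinarith [sq_nonneg (ρ * X).trace.re]

variable {ρ : Fin T → Matrix (Fin d) (Fin d) ℂ}

theorem centeredSwap_comm (ρ : Fin T → Matrix (Fin d) (Fin d) ℂ) {i j : Fin T} (h : i ≠ j) :
    centeredSwap ρ i j = centeredSwap ρ j i := by
  rw [centeredSwap_eq, centeredSwap_eq, swapOp_comm h, trace_mul_comm (ρ i)]
  abel

theorem centeredSwap_isHermitian (hρ : ∀ i, IsQuantumState (ρ i)) {i j : Fin T} (h : i ≠ j) :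
    (centeredSwap ρ i j).IsHermitian := by
  have hH := fun i => (hρ i).1.isHermitian
  rw [centeredSwap_eq, trace_mul_eq_ofReal_re (hH i) (hH j)]
  exact (((swapOp_isHermitian h).sub (localOp_isHermitian i (hH j))).sub
    (localOp_isHermitian j (hH i))).add (isHermitian_ofReal_smul_one _)

/-- The constant comes from bounding the four terms of `centeredSwap_eq` separately, each of second
moment at most `1`. -/
theorem re_trace_centeredSwap_sq_le (hρ : ∀ i, IsQuantumState (ρ i)) {i j : Fin T} (h : i ≠ j) :
    (productState ρ * (centeredSwap ρ i j * centeredSwap ρ i j)).trace.re ≤ 16 := by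
  have hH := fun i => (hρ i).1.isHermitian
  have hP := isQuantumState_productState hρ
  have ht := trace_mul_eq_ofReal_re (hH i) (hH j)
  set t := (ρ i * ρ j).trace.re with htdef
  have ht0 : 0 ≤ t := re_trace_mul_nonneg (hρ i).1 (hρ j).1
  have ht1 : t ≤ 1 := (hρ i).re_trace_mul_le_one (hρ j)
  have hloc : ∀ k l, (productState ρ * (-localOp k (ρ l) * -localOp k (ρ l))).trace.re ≤ 1 := by
    intro k l
    rw [neg_mul_neg, ← map_mul, trace_productState_mul_localOp hρ]
    exact ((hρ k).re_trace_mul_sq_le (hH l)).trans ((hρ l).re_trace_mul_le_one (hρ l))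
  have hS : (productState ρ * (swapOp i j * swapOp i j)).trace.re = 1 := by
    rw [swapOp_mul_self h, mul_one, hP.2, Complex.one_re]
  have hc : (productState ρ * (((t : ℂ) • 1) * ((t : ℂ) • 1))).trace.re ≤ 1 := by
    simp only [mul_smul_comm, mul_one, trace_smul, hP.2, smul_eq_mul,
      Complex.mul_re, Complex.ofReal_re, Complex.ofReal_im, mul_zero, sub_zero]
    nlinarith
  have hS' := swapOp_isHermitian (d := d) h
  have hA := (localOp_isHermitian i (hH j)).neg
  have hB := (localOp_isHermitian j (hH i)).neg
  have hC := isHermitian_ofReal_smul_one (ι := Fin T → Fin d) t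
  have h1 := re_trace_mul_add_sq_le hP.1 hS' hA
  have h2 := re_trace_mul_add_sq_le hP.1 hC hB
  have h3 := re_trace_mul_add_sq_le hP.1 (hS'.add hA) (hC.add hB)
  have heq : centeredSwap ρ i j =
      swapOp i j + -localOp i (ρ j) + ((t : ℂ) • 1 + -localOp j (ρ i)) := by
    rw [centeredSwap_eq, ht]; abel
  rw [heq]
  linarith [hloc i j, hloc j i]

theorem trace_centeredSwap_mul_eq_zero_of_ne (hρ : ∀ i, IsQuantumState (ρ i)) {i j k l : Fin T}
    (hj : i ≠ j) (hk : i ≠ k) (hl : i ≠ l) :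
    (productState ρ * (centeredSwap ρ i j * centeredSwap ρ k l)).trace = 0 := by
  simp only [centeredSwap, Finset.sum_mul, Finset.mul_sum, trace_sum,
    trace_localOp_mul_eq_zero ρ hj hk hl (trace_mul_centerAt (hρ i) _), Finset.sum_const_zero]

/-- Centered swaps of distinct unordered pairs are uncorrelated: some factor of the first pair is
not in the second. -/
theorem trace_centeredSwap_mul_centeredSwap_eq_zero (hρ : ∀ i, IsQuantumState (ρ i))
    {i j k l : Fin T} (hij : i ≠ j) (h : (k, l) ≠ (i, j)) (h' : (k, l) ≠ (j, i)) :
    (productState ρ * (centeredSwap ρ i j * centeredSwap ρ k l)).trace = 0 := by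
  by_cases hi : i ≠ k ∧ i ≠ l
  · exact trace_centeredSwap_mul_eq_zero_of_ne hρ hij hi.1 hi.2
  · rw [centeredSwap_comm ρ hij]
    apply trace_centeredSwap_mul_eq_zero_of_ne hρ hij.symm <;> grind

/-- For each ordered pair only the pair itself and its reversal contribute to the double sum. -/
theorem re_trace_sum_centeredSwap_sq_le (hρ : ∀ i, IsQuantumState (ρ i)) :
    (productState ρ * ((∑ p ∈ Finset.univ.offDiag, centeredSwap ρ p.1 p.2) *
      ∑ p ∈ Finset.univ.offDiag, centeredSwap ρ p.1 p.2)).trace.re ≤ 32 * (T : ℝ) ^ 2 := by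
  have key : ∀ p ∈ (Finset.univ : Finset (Fin T)).offDiag,
      ∑ q ∈ Finset.univ.offDiag,
        (productState ρ * (centeredSwap ρ p.1 p.2 * centeredSwap ρ q.1 q.2)).trace.re ≤ 32 := by
    rintro ⟨i, j⟩ hp
    have hij : i ≠ j := by simpa using hp
    have hsub : ({(i, j), (j, i)} : Finset (Fin T × Fin T)) ⊆ Finset.univ.offDiag := by
      intro q hq
      simp only [Finset.mem_insert, Finset.mem_singleton] at hq
      rcases hq with rfl | rfl
      · simpa using hij
      · simpa using hij.symm
    rw [← Finset.sum_subset hsub]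
    · rw [Finset.sum_pair (by simp [hij])]
      dsimp only
      rw [centeredSwap_comm ρ hij.symm]
      linarith [re_trace_centeredSwap_sq_le hρ hij]
    · rintro ⟨k, l⟩ _ hq'
      simp only [Finset.mem_insert, Finset.mem_singleton, not_or] at hq'
      dsimp only
      rw [trace_centeredSwap_mul_centeredSwap_eq_zero hρ hij hq'.1 hq'.2,
        Complex.zero_re]
  simp only [Finset.sum_mul, Finset.mul_sum, trace_sum, Complex.re_sum]
  rw [Finset.sum_comm]
  refine (Finset.sum_le_sum key).trans ?_
  rw [Finset.sum_const, Finset.offDiag_card, Finset.card_univ, Fintype.card_fin, nsmul_eq_mul]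
  have : ((T * T - T : ℕ) : ℝ) ≤ (T : ℝ) ^ 2 := by
    rw [sq]; exact_mod_cast Nat.sub_le _ _
  linarith

theorem re_trace_sum_localOp_centerAt_sq_le (hρ : ∀ i, IsQuantumState (ρ i))
    (X : Fin T → Matrix (Fin d) (Fin d) ℂ) (hX : ∀ i, (X i).IsHermitian) :
    (productState ρ * ((∑ i, localOp i (centerAt (ρ i) (X i))) *
      ∑ i, localOp i (centerAt (ρ i) (X i)))).trace.re ≤ ∑ i, (X i * X i).trace.re := by
  simp only [Finset.sum_mul, Finset.mul_sum, trace_sum, Complex.re_sum]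
  refine Finset.sum_le_sum fun i _ => ?_
  rw [Finset.sum_eq_single i]
  · rw [← map_mul, trace_productState_mul_localOp hρ]
    exact (re_trace_mul_centerAt_sq_le (hρ i) (hX i)).trans ((hρ i).re_trace_mul_sq_le (hX i))
  · intro j _ hji
    have := trace_localOp_mul_eq_zero ρ hji hji hji (trace_mul_centerAt (hρ j) (X j)) 1
      (centerAt (ρ i) (X i)) 1
    simp only [map_one, mul_one] at this
    rw [this, Complex.zero_re]
  · simp

/-- The observable `∑_{i ≠ j} SWAP_{ij} - 2 T ∑ i, σ_i + T² tr(σ²)`, which estimates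
`tr((∑ i, ρ i - T σ)²)` in the product of the states `ρ i`. The swaps are summed over ordered pairs,
so each unordered pair counts twice. -/
noncomputable def certificationObservable (T : ℕ) (σ : Matrix (Fin d) (Fin d) ℂ) :
    Matrix (Fin T → Fin d) (Fin T → Fin d) ℂ :=
  ∑ p ∈ (Finset.univ : Finset (Fin T)).offDiag, swapOp p.1 p.2 -
    (2 * T : ℂ) • ∑ i, localOp i σ + ((T : ℂ) ^ 2 * (σ * σ).trace) • 1

theorem certificationObservable_isHermitian {σ : Matrix (Fin d) (Fin d) ℂ} (hσ : σ.IsHermitian) :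
    (certificationObservable T σ).IsHermitian := by
  have h1 : (∑ p ∈ (Finset.univ : Finset (Fin T)).offDiag,
      swapOp (d := d) p.1 p.2).IsHermitian := by
    rw [IsHermitian, conjTranspose_sum]
    refine Finset.sum_congr rfl fun p hp => ?_
    exact swapOp_isHermitian (Finset.mem_offDiag.mp hp).2.2
  have h2 : ((2 * T : ℂ) • ∑ i : Fin T, localOp i σ).IsHermitian := by
    rw [IsHermitian, conjTranspose_smul, conjTranspose_sum]
    simp [localOp_conjTranspose, hσ.eq]
  rw [certificationObservable, trace_mul_eq_ofReal_re hσ hσ]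
  refine (h1.sub h2).add ?_
  exact_mod_cast isHermitian_ofReal_smul_one ((T : ℝ) ^ 2 * (σ * σ).trace.re)

theorem sum_offDiag_eq {M : Type*} [AddCommGroup M] (f : Fin T → Fin T → M) :
    ∑ p ∈ (Finset.univ : Finset (Fin T)).offDiag, f p.1 p.2 =
      ∑ i, (∑ j, f i j - f i i) := by
  rw [Finset.sum_sub_distrib, ← Finset.sum_product', eq_sub_iff_add_eq,
    ← Finset.diag_union_offDiag (Finset.univ : Finset (Fin T)),
    Finset.sum_union (Finset.disjoint_diag_offDiag _), Finset.sum_diag, add_comm]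

/-- The Hoeffding decomposition of the certification observable into its mean, its degenerate part
of order two and its part of order one. -/
theorem certificationObservable_sub_eq (ρ : Fin T → Matrix (Fin d) (Fin d) ℂ)
    (σ : Matrix (Fin d) (Fin d) ℂ) :
    certificationObservable T σ -
        (((∑ i, ρ i - (T : ℂ) • σ) * (∑ i, ρ i - (T : ℂ) • σ)).trace -
          ∑ i, (ρ i * ρ i).trace) • 1 =
      ∑ p ∈ Finset.univ.offDiag, centeredSwap ρ p.1 p.2 +
        (2 : ℂ) • ∑ i, localOp i (centerAt (ρ i) (∑ j, ρ j - (T : ℂ) • σ - ρ i)) := by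
  set R := ∑ j, ρ j with hR
  have hA : ∑ p ∈ (Finset.univ : Finset (Fin T)).offDiag, localOp p.1 (ρ p.2) =
      ∑ i, localOp i (R - ρ i) := by
    rw [sum_offDiag_eq (fun i j => localOp i (ρ j))]
    simp only [map_sub, hR, map_sum]
  have hB : ∑ p ∈ (Finset.univ : Finset (Fin T)).offDiag, localOp p.2 (ρ p.1) =
      ∑ i, localOp i (R - ρ i) := by
    rw [sum_offDiag_eq (fun i j => localOp j (ρ i)), Finset.sum_sub_distrib, Finset.sum_comm,
      ← Finset.sum_sub_distrib]
    simp only [map_sub, hR, map_sum]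
  have hC : ∑ p ∈ (Finset.univ : Finset (Fin T)).offDiag, (ρ p.1 * ρ p.2).trace =
      (R * R).trace - ∑ i, (ρ i * ρ i).trace := by
    rw [sum_offDiag_eq (fun i j => (ρ i * ρ j).trace), Finset.sum_sub_distrib]
    simp only [hR, Finset.sum_mul, Finset.mul_sum, trace_sum]
    rw [Finset.sum_comm]
  have hD : ∑ i, (ρ i * (R - (T : ℂ) • σ - ρ i)).trace =
      (R * R).trace - T * (R * σ).trace - ∑ i, (ρ i * ρ i).trace := by
    simp only [mul_sub, trace_sub, Finset.sum_sub_distrib, mul_smul_comm, trace_smul, smul_eq_mul,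
      ← Finset.mul_sum, ← trace_sum, ← Finset.sum_mul, ← hR]
  have hW : ∑ p ∈ (Finset.univ : Finset (Fin T)).offDiag, centeredSwap ρ p.1 p.2 =
      ∑ p ∈ (Finset.univ : Finset (Fin T)).offDiag, swapOp p.1 p.2 -
        (2 : ℂ) • ∑ i, localOp i (R - ρ i) +
        ((R * R).trace - ∑ i, (ρ i * ρ i).trace) • 1 := by
    simp only [centeredSwap_eq, Finset.sum_add_distrib, Finset.sum_sub_distrib]
    rw [hA, hB, ← Finset.sum_smul, hC, two_smul, sub_sub]
  have hL : ∑ i, localOp i (centerAt (ρ i) (R - (T : ℂ) • σ - ρ i)) =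
      ∑ i, localOp i (R - ρ i) - (T : ℂ) • ∑ i, localOp i σ -
        ((R * R).trace - T * (R * σ).trace - ∑ i, (ρ i * ρ i).trace) • 1 := by
    rw [← hD, Finset.sum_smul, Finset.smul_sum, ← Finset.sum_sub_distrib, ← Finset.sum_sub_distrib]
    refine Finset.sum_congr rfl fun i _ => ?_
    simp only [centerAt, map_sub, map_smul, map_one]
    abel
  have hE : ((R - (T : ℂ) • σ) * (R - (T : ℂ) • σ)).trace =
      (R * R).trace - 2 * T * (R * σ).trace + (T : ℂ) ^ 2 * (σ * σ).trace := by
    simp only [mul_sub, sub_mul, trace_sub, smul_mul_assoc, mul_smul_comm, trace_smul, smul_eq_mul,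
      trace_mul_comm σ R]
    ring
  rw [hW, hL, hE, certificationObservable]
  module

end Moments

/-! ### Mean, variance and separation of the certification observable -/

section Certification

open Matrix

variable {d T : ℕ}

/-- In the witness, `m = s - ∑ i, tr(ρ i ²)` is the expectation of the observable. -/
theorem exists_mean_and_variance_le {ρ : Fin T → Matrix (Fin d) (Fin d) ℂ}
    (hρ : ∀ i, IsQuantumState (ρ i)) {σ : Matrix (Fin d) (Fin d) ℂ} (hσ : σ.IsHermitian) {s : ℝ}
    (hs : (((∑ i, ρ i - (T : ℂ) • σ) * (∑ i, ρ i - (T : ℂ) • σ)).trace).re = s) :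
    ∃ m : ℝ, s - T ≤ m ∧ m ≤ s ∧
      (productState ρ * ((certificationObservable T σ - (m : ℂ) • 1) *
        (certificationObservable T σ - (m : ℂ) • 1))).trace.re ≤
          80 * (T : ℝ) ^ 2 + 16 * T * s := by
  have hH := fun i => (hρ i).1.isHermitian
  have hP := isQuantumState_productState hρ
  set D := ∑ i, ρ i - (T : ℂ) • σ with hD
  have hDH : D.IsHermitian := by
    refine IsHermitian.sub ?_ ?_
    · rw [IsHermitian, conjTranspose_sum]
      exact Finset.sum_congr rfl fun i _ => hH i
    · rw [IsHermitian, conjTranspose_smul, hσ.eq]; simp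
  have hpur : ∀ i, 0 ≤ (ρ i * ρ i).trace.re ∧ (ρ i * ρ i).trace.re ≤ 1 := fun i =>
    ⟨re_trace_mul_nonneg (hρ i).1 (hρ i).1, (hρ i).re_trace_mul_le_one (hρ i)⟩
  refine ⟨s - ∑ i, (ρ i * ρ i).trace.re, ?_, ?_, ?_⟩
  · have : ∑ i, (ρ i * ρ i).trace.re ≤ ∑ _i : Fin T, (1 : ℝ) :=
      Finset.sum_le_sum fun i _ => (hpur i).2
    simp only [Finset.sum_const, Finset.card_univ, Fintype.card_fin, nsmul_eq_mul, mul_one] at this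
    linarith
  · linarith [Finset.sum_nonneg fun i (_ : i ∈ Finset.univ) => (hpur i).1]
  · have hm : ((s - ∑ i, (ρ i * ρ i).trace.re : ℝ) : ℂ) =
        (D * D).trace - ∑ i, (ρ i * ρ i).trace := by
      rw [trace_mul_eq_ofReal_re hDH hDH, hs]
      push_cast
      exact congrArg _ (Finset.sum_congr rfl fun i _ => (trace_mul_eq_ofReal_re (hH i) (hH i)).symm)
    rw [hm, certificationObservable_sub_eq ρ σ]
    have hX : ∀ i, (D - ρ i).IsHermitian := fun i => hDH.sub (hH i)
    have hWH : (∑ p ∈ (Finset.univ : Finset (Fin T)).offDiag,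
        centeredSwap ρ p.1 p.2).IsHermitian := by
      rw [IsHermitian, conjTranspose_sum]
      exact Finset.sum_congr rfl fun p hp =>
        centeredSwap_isHermitian hρ (Finset.mem_offDiag.mp hp).2.2
    have hLH : ((2 : ℂ) • ∑ i, localOp i (centerAt (ρ i) (D - ρ i))).IsHermitian := by
      rw [IsHermitian, conjTranspose_smul, conjTranspose_sum]
      congr 1
      · simp
      · exact Finset.sum_congr rfl fun i _ =>
          localOp_isHermitian i (isHermitian_centerAt (hH i) (hX i))
    have h1 := re_trace_mul_add_sq_le hP.1 hWH hLH
    have h2 := re_trace_sum_centeredSwap_sq_le hρ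
    have h3 := re_trace_sum_localOp_centerAt_sq_le hρ (fun i => D - ρ i) hX
    have h4 : ∀ i, ((D - ρ i) * (D - ρ i)).trace.re ≤ 2 * s + 2 := by
      intro i
      have := re_trace_mul_add_sq_le (ρ := 1) PosSemidef.one hDH (hH i).neg
      simp only [one_mul, neg_mul_neg, ← sub_eq_add_neg, hs] at this
      linarith [(hpur i).2]
    have h5 : ∑ i, ((D - ρ i) * (D - ρ i)).trace.re ≤ T * (2 * s + 2) := by
      refine (Finset.sum_le_sum fun i _ => h4 i).trans ?_
      rw [Finset.sum_const, Finset.card_univ, Fintype.card_fin, nsmul_eq_mul]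
    have h6 : (productState ρ * (((2 : ℂ) • ∑ i, localOp i (centerAt (ρ i) (D - ρ i))) *
        ((2 : ℂ) • ∑ i, localOp i (centerAt (ρ i) (D - ρ i))))).trace.re =
        4 * (productState ρ * ((∑ i, localOp i (centerAt (ρ i) (D - ρ i))) *
          ∑ i, localOp i (centerAt (ρ i) (D - ρ i)))).trace.re := by
      simp only [smul_mul_assoc, mul_smul_comm, trace_smul, smul_smul, smul_eq_mul]
      rw [show (2 : ℂ) * 2 = ((4 : ℝ) : ℂ) by norm_num, Complex.re_ofReal_mul]
    have hTT : (T : ℝ) ≤ (T : ℝ) ^ 2 := by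
      rw [sq]; exact_mod_cast Nat.le_mul_self T
    rw [h6] at h1
    linarith

/-- Far in trace distance implies far in Hilbert–Schmidt distance, rescaled by `T`. -/
theorem lt_re_trace_sq_of_lt_traceDistance {ρ : Fin T → Matrix (Fin d) (Fin d) ℂ}
    (hρ : ∀ i, IsQuantumState (ρ i)) {σ : Matrix (Fin d) (Fin d) ℂ} (hσ : σ.IsHermitian)
    (hT : 0 < T) {ε : ℝ} (hε : 0 < ε) (h : ε < traceDistance (averageState ρ) σ) :
    4 * ε ^ 2 * (T : ℝ) ^ 2 <
      d * ((∑ i, ρ i - (T : ℂ) • σ) * (∑ i, ρ i - (T : ℂ) • σ)).trace.re := by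
  have hT' : (T : ℂ) ≠ 0 := by exact_mod_cast hT.ne'
  have hTr : (0 : ℝ) < T := by exact_mod_cast hT
  set Δ := averageState ρ - σ with hΔ
  have hΔH : Δ.IsHermitian := by
    refine IsHermitian.sub ?_ hσ
    rw [averageState, IsHermitian, conjTranspose_smul, conjTranspose_sum]
    simp [fun i => (hρ i).1.isHermitian.eq]
  have hD : ∑ i, ρ i - (T : ℂ) • σ = (T : ℂ) • Δ := by
    rw [hΔ, averageState, smul_sub, smul_inv_smul₀ hT']
  have hnorm : 2 * ε < schattenOneNorm Δ := by
    rw [traceDistance] at h; linarith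
  have hsq := schattenOneNorm_sq_le hΔH
  rw [Fintype.card_fin] at hsq
  have h4 : (2 * ε) ^ 2 < d * (Δ * Δ).trace.re :=
    (pow_lt_pow_left₀ hnorm (by positivity) two_ne_zero).trans_le hsq
  have : (((T : ℂ) • Δ) * ((T : ℂ) • Δ)).trace.re = (T : ℝ) ^ 2 * (Δ * Δ).trace.re := by
    simp only [smul_mul_assoc, mul_smul_comm, trace_smul, smul_eq_mul, ← mul_assoc]
    rw [show (T : ℂ) * T = ((T ^ 2 : ℝ) : ℂ) by push_cast; ring, Complex.re_ofReal_mul]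
  rw [hD, this]
  nlinarith [mul_lt_mul_of_pos_right h4 (pow_pos hTr 2)]

end Certification

theorem corollary6p3 :
    ∃ C : ℝ, 0 < C ∧
      ∀ (d : ℕ) (σ : Matrix (Fin d) (Fin d) ℂ), IsQuantumState σ →
      ∀ ε : ℝ, 0 < ε →
      ∀ T : ℕ, C * ((d : ℝ) / ε ^ 2) ≤ (T : ℝ) →
      ∃ A : OneCopyTester d T,
        ∀ ρ : Fin T → Matrix (Fin d) (Fin d) ℂ, (∀ i, IsQuantumState (ρ i)) →
          (averageState ρ = σ → 99 / 100 ≤ A.prob (productState ρ) true) ∧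
          (ε < traceDistance (averageState ρ) σ →
            99 / 100 ≤ A.prob (productState ρ) false) := by
  refine ⟨1000, by norm_num, fun d σ hσ ε hε T hT => ?_⟩
  -- In dimension zero no matrix has trace one.
  have hd : 0 < d := by
    rcases Nat.eq_zero_or_pos d with rfl | h
    · have := hσ.2
      simp [Matrix.trace] at this
    · exact h
  have hdr : (0 : ℝ) < d := by exact_mod_cast hd
  have hTr : (0 : ℝ) < T := lt_of_lt_of_le (by positivity) hT
  have hTpos : 0 < T := by exact_mod_cast hTr
  have hdε : 1000 * (d : ℝ) ≤ T * ε ^ 2 := by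
    rwa [← mul_div_assoc, div_le_iff₀ (by positivity)] at hT
  obtain ⟨A, hA⟩ := exists_threshold_measurement
    (certificationObservable_isHermitian (T := T) hσ.1.isHermitian) (200 * T)
  refine ⟨A, fun ρ hρ => ⟨fun heq => ?_, fun hfar => ?_⟩⟩
  · obtain ⟨hone, hcheb⟩ := hA _ (isQuantumState_productState hρ)
    have hzero : ∑ i, ρ i - (T : ℂ) • σ = 0 := by
      rw [← heq, averageState, smul_inv_smul₀ (by exact_mod_cast hTpos.ne'), sub_self]
    obtain ⟨m, -, hm, hvar⟩ := exists_mean_and_variance_le hρ hσ.1.isHermitian (s := 0)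
      (by rw [hzero]; simp)
    have h1 := ((hcheb m).1 (by linarith)).trans hvar
    have h2 : (200 * (T : ℝ)) ^ 2 ≤ (200 * T - m) ^ 2 :=
      pow_le_pow_left₀ (by positivity) (by linarith) 2
    -- The error is at most `80 T² / (200 T)² = 1 / 500`.
    by_contra! hlt
    have h3 : 1 / 100 < A.prob (productState ρ) false := by linarith
    nlinarith [pow_pos hTr 2]
  · obtain ⟨hone, hcheb⟩ := hA _ (isQuantumState_productState hρ)
    have hs := lt_re_trace_sq_of_lt_traceDistance hρ hσ.1.isHermitian hTpos hε hfar
    obtain ⟨m, hm, -, hvar⟩ := exists_mean_and_variance_le hρ hσ.1.isHermitian rfl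
    set s := ((∑ i, ρ i - (T : ℂ) • σ) * (∑ i, ρ i - (T : ℂ) • σ)).trace.re
    have hs' : 4000 * (T : ℝ) < s := by
      have : d * (4000 * (T : ℝ)) < d * s := by nlinarith
      exact lt_of_mul_lt_mul_left this hdr.le
    have h1 := ((hcheb m).2 (by linarith)).trans hvar
    have h2 : (s - 201 * T) ^ 2 ≤ (200 * T - m) ^ 2 := by
      rw [← neg_sub m, neg_sq]
      exact pow_le_pow_left₀ (by linarith) (by linarith) 2
    -- The error is at most `(80 T² + 16 T s) / (s - 201 T)²`, which decreases in `s` and is below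
    -- `1 / 100` from `s = 4000 T` on.
    by_contra! hlt
    have h3 : 1 / 100 < A.prob (productState ρ) true := by linarith
    have h4 : 1 / 100 * (s - 201 * T) ^ 2 ≤ A.prob (productState ρ) true * (200 * T - m) ^ 2 :=
      mul_le_mul h3.le h2 (sq_nonneg _) (by linarith)
    nlinarith [mul_pos hTr hTr, mul_pos (sub_pos.mpr hs') hTr,
      mul_pos (sub_pos.mpr hs') (sub_pos.mpr hs')]
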